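/- Let $d\ge 3$, let $\mathbb T_d$ be the homogeneous tree of degree $d$ (the infinite tree in which every vertex has exactly $d$ neighbours), and fix a vertex $\mathbf 0$ of it as root. Let $\eta$ be a random variable with values in $\{0,1,2,\dots\}$. For $p\in[0,1]$, the frog model on $\mathbb T_d$ with parameters $p,\eta$ is defined as follows. Let $\eta(x)$, $(S^x_n(i))_{n\ge 0}$ and $\Xi^x(i)$, for vertices $x$ and $i=1,2,\dots$, be independent, where $\eta(x)$ has the law of $\eta$ (the initial number of particles at $x$), $(S^x_n(i))_{n\ge 0}$ is a simple random walk on $\mathbb T_d$ started at $x$, and the lifetime satisfies $\mathbf P[\Xi^x(i)=k]=(1-p)p^{k-1}$ for $k=1,2,\dots$ (with $\Xi^x(i)=\infty$ if $p=1$). Put $$t(x,y)=\min_{1\le i\le\eta(x)}\min\{n<\Xi^x(i): S^x_n(i)=y\},\qquad T(x)=\inf\{t(x_0,x_1)+\dots+t(x_{m-1},x_m)\},$$ where $\min\emptyset=\infty$ and the infimum is over all finite sequences $\mathbf 0=x_0,x_1,\dots,x_m=x$ (so $T(\mathbf 0)=0$). The $i$-th particle from $x$, $1\le i\le\eta(x)$,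 is active at time $n$ if $T(x)\le n<T(x)+\Xi^x(i)$, and the model survives if at every time $n=0,1,2,\dots$ there is at least one active particle. Let $$p_c(\mathbb T_d,\eta)=\inf\{p\in[0,1]:\mathbf P[\text{the model with parameters }p,\eta\text{ survives}]>0\}.$$ If $\mathbf P[\eta\ge 1]>0$, then $p_c(\mathbb T_d,\eta)<1$. -/

import Mathlib

open MeasureTheory ProbabilityTheory
open scoped ENNReal unitInterval

noncomputable section

namespace FrogModel

variable {V : Type*}

/-- The law of one step of simple random walk from `x`: uniform on the neighbours of `x`.
(At an isolated vertex, which does not occur in an infinite connected graph, the walk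
stays put.) -/
def stepLaw [MeasurableSpace V] (G : SimpleGraph V) [G.LocallyFinite] (x : V) : Measure V :=
  open Classical in
  if h : (G.neighborFinset x).Nonempty then (PMF.uniformOfFinset (G.neighborFinset x) h).toMeasure
  else Measure.dirac x

instance [MeasurableSpace V] (G : SimpleGraph V) [G.LocallyFinite] (x : V) :
    IsProbabilityMeasure (stepLaw G x) := by
  unfold stepLaw
  split_ifs <;> infer_instance

/-- The transition kernel of simple random walk, as a function of the trajectory up to time `n`;
it depends on the current position only. -/
def stepKernel [MeasurableSpace V] [DiscreteMeasurableSpace V] (G : SimpleGraph V)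
    [G.LocallyFinite] (n : ℕ) : Kernel (Finset.Iic n → V) V where
  toFun w := stepLaw G (w ⟨n, Finset.mem_Iic.2 le_rfl⟩)
  measurable' := (Measurable.of_discrete (f := stepLaw G)).comp (measurable_pi_apply _)

instance [MeasurableSpace V] [DiscreteMeasurableSpace V] (G : SimpleGraph V)
    [G.LocallyFinite] (n : ℕ) : IsMarkovKernel (stepKernel G n) :=
  ⟨fun w => inferInstanceAs (IsProbabilityMeasure (stepLaw G (w ⟨n, Finset.mem_Iic.2 le_rfl⟩)))⟩

/-- The law on `ℕ → V` of simple random walk on `G` started at `x`. -/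
def srwLaw [MeasurableSpace V] [DiscreteMeasurableSpace V] (G : SimpleGraph V)
    [G.LocallyFinite] (x : V) : Measure (ℕ → V) :=
  Kernel.traj (X := fun _ => V) (stepKernel G) 0 (fun _ => x)

instance [MeasurableSpace V] [DiscreteMeasurableSpace V] (G : SimpleGraph V)
    [G.LocallyFinite] (x : V) : IsProbabilityMeasure (srwLaw G x) := by
  unfold srwLaw
  infer_instance

/-- The law of the lifetime of a particle: `P[Ξ = k] = (1 - p) p ^ (k - 1)` for `k = 1, 2, …`
if `p < 1`, and `Ξ = ∞` if `p = 1`. -/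
def lifetimeLaw (p : I) : Measure ℕ∞ :=
  open Classical in
  if p = 1 then Measure.dirac ⊤
  else (geometricMeasure (σ p)).map (fun n : ℕ => ((n + 1 : ℕ) : ℕ∞))

instance (p : I) : IsProbabilityMeasure (lifetimeLaw p) := by
  unfold lifetimeLaw
  split_ifs
  · infer_instance
  · exact Measure.isProbabilityMeasure_map Measurable.of_discrete.aemeasurable

/-- A realization of the randomness: the initial numbers of particles `η(x)`, the trajectories
`S^x(i)` and the lifetimes `Ξ^x(i)`. Particles at a site are numbered `0, 1, 2, …`; those
actually present at `x` are the ones with `i < η(x)`. -/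
abbrev Config (V : Type*) : Type _ := (V → ℕ) × (V × ℕ → ℕ → V) × (V × ℕ → ℕ∞)

namespace Config

/-- The initial number of particles at `x`. -/
def count (ω : Config V) (x : V) : ℕ := ω.1 x

/-- The position after `n` steps of the `i`-th particle from `x`. -/
def walk (ω : Config V) (x : V) (i n : ℕ) : V := ω.2.1 (x, i) n

/-- The lifetime of the `i`-th particle from `x`. -/
def lifetime (ω : Config V) (x : V) (i : ℕ) : ℕ∞ := ω.2.2 (x, i)

/-- `t(x, y)`: the time, counted from the activation of `x`, at which `y` is first visited by a
living particle from `x`; it is `∞` if there is no such visit. -/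
def passageTime (ω : Config V) (x y : V) : ℕ∞ :=
  ⨅ (i : ℕ) (_ : i < ω.count x) (n : ℕ) (_ : (n : ℕ∞) < ω.lifetime x i ∧ ω.walk x i n = y),
    (n : ℕ∞)

/-- `T(x)`: the moment when the particles at `x` are awakened, the infimum of
`t(x₀, x₁) + ⋯ + t(xₘ₋₁, xₘ)` over all finite sequences from the root `o` to `x`. -/
def wakeTime (ω : Config V) (o x : V) : ℕ∞ :=
  ⨅ (m : ℕ) (s : ℕ → V) (_ : s 0 = o ∧ s m = x),
    ∑ j ∈ Finset.range m, ω.passageTime (s j) (s (j + 1))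

/-- The `i`-th particle from `x` is present and active at time `n`. -/
def IsActive (ω : Config V) (o x : V) (i n : ℕ) : Prop :=
  i < ω.count x ∧ ω.wakeTime o x ≤ n ∧ (n : ℕ∞) < ω.wakeTime o x + ω.lifetime x i

/-- The realization survives: at every instant of time there is an active particle. -/
def Survives (ω : Config V) (o : V) : Prop :=
  ∀ n : ℕ, ∃ (x : V) (i : ℕ), ω.IsActive o x i n

end Config

/-- The law of the frog model on `G` with survival parameter `p`, where `η` is the law of the
initial number of particles at a site: all initial numbers, walks and lifetimes are
independent. -/
def law [MeasurableSpace V] [DiscreteMeasurableSpace V] (G : SimpleGraph V) [G.LocallyFinite]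
    (p : I) (η : Measure ℕ) [IsProbabilityMeasure η] : Measure (Config V) :=
  (Measure.infinitePi fun _ : V => η).prod
    ((Measure.infinitePi fun a : V × ℕ => srwLaw G a.1).prod
      (Measure.infinitePi fun _ : V × ℕ => lifetimeLaw p))

/-- The critical parameter `p_c(G, η)`, for the root `o`: the infimum of all `p ∈ [0, 1]` for
which the frog model survives with positive probability. It is taken in `[0, 1]`, so the infimum
of the empty set would be `1`. -/
def criticalParameter [MeasurableSpace V] [DiscreteMeasurableSpace V] (G : SimpleGraph V)
    [G.LocallyFinite] (o : V) (η : Measure ℕ) [IsProbabilityMeasure η] : I :=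
  sInf {p : I | 0 < law G p η {ω | ω.Survives o}}

end FrogModel

end

/-! Write `d = b + 1` and `q = P[η ≥ 1]`; at most one particle per site is used. Let `h` be the
chance that a particle visits a given neighbour of its start while alive. First-step analysis gives
`h (b + 1) = p (1 + b h ^ 2)`, and a vertex at distance `k` is visited with probability `h ^ k`;
only the lower bound is needed (`law_reaches_ge`). Since `1 + b h ^ 2 - h (b + 1) = (1 - h) (1 - b
h)`, every `0 < h < 1 / b` comes from some `p < 1`, so `h` can serve as the parameter.

One particle is not enough: the mean number of descendants it visits in generation `n` is of order
`(b h) ^ n`, which decays. The gain comes from relays: along a ray it suffices that each edge is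
crossed by some particle started earlier on that ray. With `r = 1 + q (1 - h)`, this covers `n + 1`
edges with probability at least `q h ^ (n + 1) r ^ n` (`le_measureReal_coverReach`). At `h = 1 / b`
one has `b h r > 1`, so by continuity this persists for some `h < 1 / b` (`exists_supercritical`),
and for large `N` the mean number of covered rays of length `N` exceeds `1`.

Coverage of `N` generations uses only particles strictly before the last one, so the process
restarts independently at the endpoints of covered rays. For this supercritical process,
`le_measureReal_exists_good` shows that a small `θ > 0` is preserved by induction as a lower bound
for reaching generation `n * N`. In the limit, vertices arbitrarily far away are woken with
probability at least `θ`, and `survives_of_unbounded` gives survival. -/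

noncomputable section

namespace FrogModel

variable {V : Type*}

/-! ### Trees -/

section Graph

variable {G : SimpleGraph V}

/-- The first `n` steps of a nearest-neighbour trajectory form a walk in the graph. -/
lemma exists_walk_of_trajectory {w : ℕ → V} (hw : ∀ n, G.Adj (w n) (w (n + 1))) (n : ℕ) :
    ∃ p : G.Walk (w 0) (w n), p.length = n ∧ ∀ v ∈ p.support, ∃ j ≤ n, w j = v := by
  induction n with
  | zero => exact ⟨.nil, rfl, by simp⟩
  | succ n ih =>
    obtain ⟨p, hl, hp⟩ := ih
    refine ⟨p.concat (hw n), by simp [hl], fun v hv => ?_⟩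
    rw [SimpleGraph.Walk.support_concat, List.mem_append, List.mem_singleton] at hv
    rcases hv with hv | rfl
    · obtain ⟨j, hj, rfl⟩ := hp v hv
      exact ⟨j, by omega, rfl⟩
    · exact ⟨n + 1, le_rfl, rfl⟩

lemma dist_trajectory_le {w : ℕ → V} (hw : ∀ n, G.Adj (w n) (w (n + 1))) (n : ℕ) :
    G.dist (w 0) (w n) ≤ n := by
  obtain ⟨p, hl, -⟩ := exists_walk_of_trajectory hw n
  exact (SimpleGraph.dist_le p).trans_eq hl

/-- In a tree, every walk from `x` to `z` visits the vertices of the geodesic from `x` to `z`. -/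
lemma mem_support_of_dist_add_dist (hG : G.IsTree) {x y z : V}
    (h : G.dist x y + G.dist y z = G.dist x z) (p : G.Walk x z) : y ∈ p.support := by
  classical
  obtain ⟨p₁, h₁⟩ := hG.1.exists_walk_length_eq_dist x y
  obtain ⟨p₂, h₂⟩ := hG.1.exists_walk_length_eq_dist y z
  have hpath : (p₁.append p₂).IsPath :=
    SimpleGraph.Walk.isPath_of_length_eq_dist _ (by rw [SimpleGraph.Walk.length_append]; omega)
  have heq := (hG.existsUnique_path x z).unique hpath p.bypass_isPath
  apply p.support_bypass_subset_support
  rw [← heq, SimpleGraph.Walk.mem_support_append_iff]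
  exact Or.inl p₁.end_mem_support

/-- In a tree, a vertex has at most one neighbour that is closer to the root. -/
lemma parent_unique (hG : G.IsTree) {o v x y : V} (hx : G.Adj x v) (hy : G.Adj y v)
    (hxd : G.dist o v = G.dist o x + 1) (hyd : G.dist o v = G.dist o y + 1) : x = y := by
  obtain ⟨p, hp⟩ := hG.1.exists_walk_length_eq_dist o x
  obtain ⟨r, hr⟩ := hG.1.exists_walk_length_eq_dist o y
  have hp' : (p.concat hx).IsPath := SimpleGraph.Walk.isPath_of_length_eq_dist _ (by simp; omega)
  have hr' : (r.concat hy).IsPath := SimpleGraph.Walk.isPath_of_length_eq_dist _ (by simp; omega)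
  have heq := (hG.existsUnique_path o v).unique hp' hr'
  simpa using congrArg SimpleGraph.Walk.penultimate heq

/-- In a tree of degree `b + 1`, every vertex has `b` chosen children with respect to the root,
and a vertex determines its parent and its place among the children. -/
lemma exists_child [G.LocallyFinite] (hG : G.IsTree) {b : ℕ}
    (hreg : G.IsRegularOfDegree (b + 1)) (o : V) :
    ∃ c : V → Fin b → V, (∀ x a, G.Adj x (c x a)) ∧
      (∀ x a, G.dist o (c x a) = G.dist o x + 1) ∧
      ∀ x a y e, c x a = c y e → x = y ∧ a = e := by
  classical
  have key : ∀ x : V, ∃ f : Fin b → V, Function.Injective f ∧ (∀ a, G.Adj x (f a)) ∧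
      ∀ a, G.dist o (f a) = G.dist o x + 1 := by
    intro x
    set S := (G.neighborFinset x).filter (fun z => G.dist o z = G.dist o x + 1) with hS
    set S' := (G.neighborFinset x).filter (fun z => ¬ G.dist o z = G.dist o x + 1) with hS'
    have hcard : S.card + S'.card = b + 1 := by
      rw [hS, hS', Finset.card_filter_add_card_filter_not, SimpleGraph.card_neighborFinset_eq_degree]
      exact hreg x
    -- In a tree, a neighbour that is not one step farther from `o` is one step nearer, hence the
    -- parent. At the root `S'` is empty, and one of the `b + 1` children is left out.
    have hS'1 : S'.card ≤ 1 := by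
      rw [Finset.card_le_one]
      intro y hy z hz
      simp only [hS', Finset.mem_filter, SimpleGraph.mem_neighborFinset] at hy hz
      have h1 := (hG.dist_eq_dist_add_one_of_adj o hy.1).resolve_right hy.2
      have h2 := (hG.dist_eq_dist_add_one_of_adj o hz.1).resolve_right hz.2
      exact parent_unique hG hy.1.symm hz.1.symm h1 h2
    have hb : Fintype.card (Fin b) ≤ Fintype.card S := by
      rw [Fintype.card_fin, Fintype.card_coe]; omega
    obtain ⟨f⟩ := Function.Embedding.nonempty_of_card_le hb
    have hf : ∀ a, G.Adj x (f a) ∧ G.dist o (f a) = G.dist o x + 1 := fun a => by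
      have h := (f a).2
      have h' := Finset.mem_filter.1 h
      rwa [SimpleGraph.mem_neighborFinset] at h'
    exact ⟨fun a => f a, Subtype.val_injective.comp f.injective, fun a => (hf a).1,
      fun a => (hf a).2⟩
  choose c hinj hadj hdist using key
  refine ⟨c, hadj, hdist, fun x a y e h => ?_⟩
  have hxy : x = y := by
    refine parent_unique (v := c x a) hG (hadj x a) (h ▸ hadj y e) (hdist x a) ?_
    rw [h, hdist]
  subst hxy
  exact ⟨rfl, hinj x h⟩

/-- A locally finite connected graph is countable. -/
lemma countable_of_connected [G.LocallyFinite] (hG : G.Connected) : Countable V := by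
  obtain ⟨o⟩ := hG.nonempty
  have hfin : ∀ n, {v | G.dist o v = n}.Finite := by
    intro n
    induction n with
    | zero =>
      refine (Set.finite_singleton o).subset fun v hv => ?_
      exact (hG.dist_eq_zero_iff.1 hv).symm
    | succ n ih =>
      refine (ih.biUnion fun x _ => (G.neighborFinset x).finite_toSet).subset fun v hv => ?_
      obtain ⟨p, hp⟩ := hG.exists_walk_length_eq_dist o v
      rw [Set.mem_ofPred_eq] at hv
      have hnil : ¬ p.Nil := by
        rw [← SimpleGraph.Walk.length_eq_zero_iff]; omega
      have hadj := p.adj_penultimate hnil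
      have h1 : G.dist o p.penultimate ≤ n := by
        refine (SimpleGraph.dist_le p.dropLast).trans ?_
        simp; omega
      have h2 : G.dist o v ≤ G.dist o p.penultimate + 1 := by
        refine (hG.dist_triangle (v := p.penultimate)).trans ?_
        rw [SimpleGraph.dist_eq_one_iff_adj.2 hadj]
      simp only [Set.mem_iUnion, Set.mem_ofPred_eq, Finset.mem_coe, SimpleGraph.mem_neighborFinset]
      exact ⟨_, by omega, hadj⟩
  have huniv : (Set.univ : Set V) = ⋃ n, {v | G.dist o v = n} := by
    ext v; simp
  rw [← Set.countable_univ_iff, huniv]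
  exact Set.countable_iUnion fun n => (hfin n).countable

end Graph

/-! ### Deterministic properties of a realization -/

section Deterministic

variable {G : SimpleGraph V}

lemma wakeTime_root (ω : Config V) (o : V) : ω.wakeTime o o = 0 := by
  refine le_antisymm ?_ bot_le
  refine (iInf_le _ 0).trans ((iInf_le _ (fun _ => o)).trans ((iInf_le _ ⟨rfl, rfl⟩).trans ?_))
  simp

/-- The waking time is attained along some finite sequence of vertices. -/
lemma exists_wakeTime_eq (ω : Config V) (o x : V) (h : ω.wakeTime o x < ⊤) :
    ∃ (m : ℕ) (s : ℕ → V), s 0 = o ∧ s m = x ∧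
      ∑ j ∈ Finset.range m, ω.passageTime (s j) (s (j + 1)) ≤ ω.wakeTime o x := by
  -- Times are integers, so a sequence beating the infimum plus one attains it.
  have hlt : ω.wakeTime o x < ω.wakeTime o x + 1 := ENat.lt_add_one_iff h.ne |>.2 le_rfl
  conv_lhs at hlt => rw [Config.wakeTime]
  simp only [iInf_lt_iff] at hlt
  obtain ⟨m, s, ⟨h0, hm⟩, hs⟩ := hlt
  exact ⟨m, s, h0, hm, (ENat.lt_add_one_iff h.ne).1 hs⟩

lemma wakeTime_le_add (ω : Config V) (o x y : V) :
    ω.wakeTime o y ≤ ω.wakeTime o x + ω.passageTime x y := by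
  rcases eq_or_ne (ω.wakeTime o x) ⊤ with h | h
  · simp [h]
  obtain ⟨m, s, h0, hm, hs⟩ := exists_wakeTime_eq ω o x h.lt_top
  refine le_trans ?_ (add_le_add_left hs _)
  refine (iInf_le _ (m + 1)).trans ((iInf_le _ (Function.update s (m + 1) y)).trans
    ((iInf_le _ ⟨by simp [h0], by simp⟩).trans (le_of_eq ?_)))
  rw [Finset.sum_range_succ, Function.update_self, Function.update_of_ne (by omega), hm]
  congr 1
  refine Finset.sum_congr rfl fun j hj => ?_
  rw [Finset.mem_range] at hj
  rw [Function.update_of_ne (by omega), Function.update_of_ne (by omega)]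

/-- All trajectories start at their sites and go from neighbour to neighbour. -/
def NearestNeighbour (G : SimpleGraph V) (ω : Config V) : Prop :=
  ∀ x i, ω.walk x i 0 = x ∧ ∀ n, G.Adj (ω.walk x i n) (ω.walk x i (n + 1))

lemma dist_le_passageTime {ω : Config V} (hω : NearestNeighbour G ω) (x y : V) :
    (G.dist x y : ℕ∞) ≤ ω.passageTime x y := by
  refine le_iInf fun i => le_iInf fun _ => le_iInf fun n => le_iInf fun h => ?_
  have := dist_trajectory_le (hω x i).2 n
  rw [(hω x i).1, h.2] at this
  exact_mod_cast this

/-- Activation spreads at speed at most one, so unbounded reach means unbounded waking times. -/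
lemma dist_le_wakeTime (hG : G.Connected) {ω : Config V} (hω : NearestNeighbour G ω) (o x : V) :
    (G.dist o x : ℕ∞) ≤ ω.wakeTime o x := by
  refine le_iInf fun m => le_iInf fun s => le_iInf fun h => ?_
  obtain ⟨rfl, rfl⟩ := h
  induction m with
  | zero => simp
  | succ m ih =>
    rw [Finset.sum_range_succ]
    refine le_trans ?_ (add_le_add ih (dist_le_passageTime hω _ _))
    exact_mod_cast hG.dist_triangle

/-- If vertices are woken at arbitrarily large distances, then there are active particles at all
times. -/
lemma survives_of_unbounded (hG : G.Connected) {ω : Config V} (hω : NearestNeighbour G ω) (o : V)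
    (h : ∀ n : ℕ, ∃ x, n ≤ G.dist o x ∧ ω.wakeTime o x < ⊤) : ω.Survives o := by
  intro n
  obtain ⟨x, hx, hxT⟩ := h (n + 1)
  obtain ⟨m, s, h0, hm, hs⟩ := exists_wakeTime_eq ω o x hxT
  have hlast : (n : ℕ∞) < ω.wakeTime o (s m) := by
    refine lt_of_lt_of_le ?_ (dist_le_wakeTime hG hω o (s m))
    rw [hm]
    exact_mod_cast hx
  -- Take the first vertex of the sequence woken after time `n`. Its predecessor is awake by time
  -- `n`, and any particle from there that visits the vertex while alive is still active at time
  -- `n`.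
  have hex : ∃ j, (n : ℕ∞) < ω.wakeTime o (s j) := ⟨m, hlast⟩
  classical
  obtain ⟨k, hk⟩ : ∃ k, Nat.find hex = k + 1 := by
    refine Nat.exists_eq_succ_of_ne_zero fun h => ?_
    have := Nat.find_spec hex
    rw [h, h0, wakeTime_root] at this
    simp at this
  have hk1 : (n : ℕ∞) < ω.wakeTime o (s (k + 1)) := hk ▸ Nat.find_spec hex
  have hk0 : ω.wakeTime o (s k) ≤ n := not_lt.1 (Nat.find_min hex (by omega))
  have hkm : k < m := by
    have := Nat.find_min' hex hlast
    omega
  have hpass : ω.passageTime (s k) (s (k + 1)) < ⊤ := by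
    refine lt_of_le_of_lt ?_ (lt_of_le_of_lt hs hxT)
    exact Finset.single_le_sum (f := fun j => ω.passageTime (s j) (s (j + 1)))
      (fun _ _ => bot_le) (Finset.mem_range.2 hkm)
  rw [Config.passageTime] at hpass
  simp only [iInf_lt_iff] at hpass
  obtain ⟨i, hi, l, hl, -⟩ := hpass
  refine ⟨s k, i, hi, hk0, hk1.trans_le ((wakeTime_le_add ω o (s k) _).trans ?_)⟩
  gcongr
  refine le_trans ?_ hl.1.le
  exact (iInf_le _ i).trans ((iInf_le _ hi).trans ((iInf_le _ l).trans (iInf_le _ hl)))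

/-- The first particle of `x` is present and visits `y` during its lifetime. -/
def Reaches (ω : Config V) (x y : V) : Prop :=
  1 ≤ ω.count x ∧ ∃ n : ℕ, (n : ℕ∞) < ω.lifetime x 0 ∧ ω.walk x 0 n = y

lemma Reaches.wakeTime_lt_top {ω : Config V} {o x y : V} (h : Reaches ω x y)
    (hx : ω.wakeTime o x < ⊤) : ω.wakeTime o y < ⊤ := by
  refine lt_of_le_of_lt (wakeTime_le_add ω o x y) ?_
  obtain ⟨hc, n, hn⟩ := h
  rw [ENat.add_lt_top]
  refine ⟨hx, lt_of_le_of_lt ((iInf_le _ 0).trans ((iInf_le _ hc).trans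
    ((iInf_le _ n).trans (iInf_le _ hn)))) (ENat.natCast_lt_top n)⟩

/-- In a tree, a particle that reaches `z` reaches the vertices on the geodesic to `z`. -/
lemma Reaches.of_dist_add_dist (hG : G.IsTree) {ω : Config V} (hω : NearestNeighbour G ω)
    {x y z : V} (h : Reaches ω x z) (hd : G.dist x y + G.dist y z = G.dist x z) :
    Reaches ω x y := by
  obtain ⟨hc, n, hn, rfl⟩ := h
  obtain ⟨p, -, hp⟩ := exists_walk_of_trajectory (hω x 0).2 n
  obtain ⟨j, hj, hjy⟩ := hp y (mem_support_of_dist_add_dist hG (by rwa [(hω x 0).1]) p)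
  exact ⟨hc, j, lt_of_le_of_lt (by exact_mod_cast hj) hn, hjy⟩

end Deterministic

/-! ### Simple random walk -/

section Walk

lemma stepLaw_eq [MeasurableSpace V] (G : SimpleGraph V) [G.LocallyFinite] {x : V}
    (h : (G.neighborFinset x).Nonempty) :
    stepLaw G x = (PMF.uniformOfFinset (G.neighborFinset x) h).toMeasure := by
  rw [stepLaw, dif_pos h]

/-- The trajectories whose first visit to `y` occurs at time `n`. -/
def firstHit (y : V) (n : ℕ) : Set (ℕ → V) := {w | w n = y ∧ ∀ j < n, w j ≠ y}

lemma measurableSet_firstHit [MeasurableSpace V] [MeasurableSingletonClass V] (y : V) (n : ℕ) :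
    MeasurableSet (firstHit y n) := by
  have h : firstHit y n = (fun w => w n) ⁻¹' {y} ∩ ⋂ j ∈ Set.Iio n, (fun w => w j) ⁻¹' {y}ᶜ := by
    ext w; simp [firstHit]
  rw [h]
  refine (measurable_pi_apply n (measurableSet_singleton y)).inter ?_
  exact MeasurableSet.biInter (Set.to_countable _)
    fun j _ => measurable_pi_apply j (measurableSet_singleton y).compl

variable [MeasurableSpace V] [DiscreteMeasurableSpace V] (G : SimpleGraph V) [G.LocallyFinite]

/-- The Markov property of simple random walk, for one step. -/
lemma lintegral_srwLaw_succ [Countable V] (x : V) (n : ℕ)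
    (f : (Finset.Iic n → V) → V → ℝ≥0∞) :
    ∫⁻ w, f (Preorder.frestrictLe n w) (w (n + 1)) ∂srwLaw G x =
      ∫⁻ w, ∫⁻ z, f (Preorder.frestrictLe n w) z ∂stepLaw G (w n) ∂srwLaw G x := by
  have hf : Measurable (Function.uncurry f) := Measurable.of_discrete
  have hpair : Measurable
      (fun w : ℕ → V => (Preorder.frestrictLe (π := fun _ => V) n w, w (n + 1))) := by fun_prop
  have key := Kernel.partialTraj_compProd_eq_map_traj (X := fun _ => V) (κ := stepKernel G)
    (Nat.zero_le n) (x₀ := fun _ => x)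
  have h1 : ∫⁻ w, f (Preorder.frestrictLe n w) (w (n + 1)) ∂srwLaw G x =
      ∫⁻ u, Function.uncurry f u ∂((srwLaw G x).map
        (fun w : ℕ → V => (Preorder.frestrictLe (π := fun _ => V) n w, w (n + 1)))) := by
    rw [lintegral_map hf hpair]; rfl
  rw [h1, srwLaw, ← key, Measure.lintegral_compProd hf, ← Kernel.traj_map_frestrictLe,
    Kernel.map_apply _ (Preorder.measurable_frestrictLe n),
    lintegral_map Measurable.of_discrete (Preorder.measurable_frestrictLe n)]
  rfl

lemma ae_srwLaw_zero [Countable V] (x : V) : ∀ᵐ w ∂srwLaw G x, w 0 = x := by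
  have h := Kernel.traj_map_frestrictLe_apply (X := fun _ => V) (κ := stepKernel G) 0 0
    (fun _ => x)
  rw [Kernel.partialTraj_self, Kernel.id_apply] at h
  have h2 : ∀ᵐ r ∂((srwLaw G x).map (Preorder.frestrictLe (π := fun _ => V) 0)),
      r ⟨0, Finset.mem_Iic.2 le_rfl⟩ = x := by
    rw [srwLaw, h, ae_dirac_eq]
    exact rfl
  exact ae_of_ae_map (Preorder.measurable_frestrictLe 0).aemeasurable h2

lemma lintegral_stepLaw {d : ℕ} (hd : 0 < d) (hreg : G.IsRegularOfDegree d) (x : V)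
    [Countable V] (f : V → ℝ≥0∞) :
    ∫⁻ z, f z ∂stepLaw G x = (d : ℝ≥0∞)⁻¹ * ∑ z ∈ G.neighborFinset x, f z := by
  have hne : (G.neighborFinset x).Nonempty := by
    rw [← Finset.card_pos, SimpleGraph.card_neighborFinset_eq_degree, hreg x]; exact hd
  classical
  rw [stepLaw_eq G hne, lintegral_countable', Finset.mul_sum, tsum_eq_sum (s := G.neighborFinset x)]
  · refine Finset.sum_congr rfl fun z hz => ?_
    rw [PMF.toMeasure_apply_singleton _ _ (measurableSet_singleton z),
      PMF.uniformOfFinset_apply_of_mem hne hz, SimpleGraph.card_neighborFinset_eq_degree, hreg x,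
      mul_comm]
  · intro z hz
    rw [PMF.toMeasure_apply_singleton _ _ (measurableSet_singleton z),
      PMF.uniformOfFinset_apply_of_notMem hne hz, mul_zero]

lemma ae_srwLaw_adj [Countable V] {d : ℕ} (hd : 0 < d) (hreg : G.IsRegularOfDegree d) (x : V) :
    ∀ᵐ w ∂srwLaw G x, ∀ n, G.Adj (w n) (w (n + 1)) := by
  classical
  rw [ae_all_iff]
  intro n
  have h := lintegral_srwLaw_succ G x n
    (fun r z => if G.Adj (r ⟨n, Finset.mem_Iic.2 le_rfl⟩) z then 0 else 1)
  have h0 : ∀ w : ℕ → V, ∫⁻ z, (if G.Adj (w n) z then (0 : ℝ≥0∞) else 1) ∂stepLaw G (w n) = 0 := by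
    intro w
    rw [lintegral_stepLaw G hd hreg, Finset.sum_eq_zero, mul_zero]
    intro z hz
    rw [if_pos ((G.mem_neighborFinset _ _).1 hz)]
  have h1 : ∫⁻ w, (if G.Adj (w n) (w (n + 1)) then (0 : ℝ≥0∞) else 1) ∂srwLaw G x = 0 := by
    refine h.trans ?_
    exact (lintegral_congr h0).trans lintegral_zero
  have hpair : Measurable (fun w : ℕ → V => (w n, w (n + 1))) := by fun_prop
  have hmeas : Measurable (fun w : ℕ → V => if G.Adj (w n) (w (n + 1)) then (0 : ℝ≥0∞) else 1) :=
    (Measurable.of_discrete (f := fun u : V × V => if G.Adj u.1 u.2 then (0 : ℝ≥0∞) else 1)).comp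
      hpair
  rw [lintegral_eq_zero_iff hmeas] at h1
  filter_upwards [h1] with w hw
  by_contra hc
  simp [hc] at hw

/-- A function that is subharmonic for the killed walk away from `y` is bounded by the discounted
hitting probabilities of `y` up to a vanishing error. -/
lemma le_sum_firstHit [Countable V] (x y : V) (p : ℝ≥0∞) (hp : p ≤ 1) (g : V → ℝ≥0∞)
    (hg1 : ∀ v, g v ≤ 1) (hg : ∀ v ≠ y, g v ≤ p * ∫⁻ z, g z ∂stepLaw G v) (m : ℕ) :
    g x ≤ ∑ j ∈ Finset.range m, p ^ j * srwLaw G x (firstHit y j) + p ^ m := by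
  classical
  set μ := srwLaw G x with hμ
  have hmeas : ∀ m n, Measurable (fun w : ℕ → V =>
      if ∀ j < m, w j ≠ y then g (w n) else (0 : ℝ≥0∞)) := by
    intro m n
    refine Measurable.ite ?_ ((Measurable.of_discrete (f := g)).comp (measurable_pi_apply n))
      measurable_const
    have : {w : ℕ → V | ∀ j < m, w j ≠ y} = ⋂ j ∈ Set.Iio m, (fun w => w j) ⁻¹' {y}ᶜ := by
      ext w; simp
    rw [this]
    exact MeasurableSet.biInter (Set.to_countable _)
      fun j _ => measurable_pi_apply j (measurableSet_singleton y).compl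
  -- Optional stopping at the first visit to `y`: the remainder is the discounted mean of `g` over
  -- trajectories that have not visited `y` before time `m`. At each step, those at `y` are paid off
  -- with `g ≤ 1`, the others by subharmonicity and the Markov property.
  have key : ∀ m, g x ≤ ∑ j ∈ Finset.range m, p ^ j * μ (firstHit y j) +
      p ^ m * ∫⁻ w, (if ∀ j < m, w j ≠ y then g (w m) else 0) ∂μ := by
    intro m
    induction m with
    | zero =>
      rw [Finset.sum_range_zero, zero_add, pow_zero, one_mul]
      refine (Eq.trans (lintegral_congr_ae (g := fun _ => g x) ?_) (by simp [hμ])).ge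
      filter_upwards [ae_srwLaw_zero G x] with w hw
      simp [hw]
    | succ m ih =>
      refine ih.trans ?_
      rw [Finset.sum_range_succ, add_assoc, pow_succ, mul_assoc, ← mul_add]
      gcongr
      have hsplit : ∫⁻ w, (if ∀ j < m, w j ≠ y then g (w m) else 0) ∂μ ≤
          ∫⁻ w, ((firstHit y m).indicator 1 w +
            if ∀ j < m + 1, w j ≠ y then g (w m) else 0) ∂μ := by
        refine lintegral_mono fun w => ?_
        by_cases h1 : ∀ j < m, w j ≠ y
        · by_cases h2 : w m = y
          · have : w ∈ firstHit y m := ⟨h2, h1⟩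
            simp only [if_pos h1, Set.indicator_of_mem this, Pi.one_apply]
            exact (hg1 _).trans le_self_add
          · have h3 : ∀ j < m + 1, w j ≠ y := fun j hj => by
              rcases Nat.lt_succ_iff_lt_or_eq.1 hj with h | rfl
              exacts [h1 j h, h2]
            simp only [if_pos h1, if_pos h3]
            exact le_add_self
        · simp [h1]
      refine hsplit.trans ?_
      rw [lintegral_add_right _ (hmeas (m + 1) m),
        lintegral_indicator_one (measurableSet_firstHit y m)]
      gcongr
      have hnext := lintegral_srwLaw_succ G x m (fun r z =>
        if ∀ (j : ℕ) (hj : j < m + 1), r ⟨j, Finset.mem_Iic.2 (Nat.lt_succ_iff.1 hj)⟩ ≠ y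
          then g z else 0)
      refine le_trans ?_ (mul_le_mul_right hnext.ge p)
      rw [← lintegral_const_mul' _ _ (ne_top_of_le_ne_top ENNReal.one_ne_top hp)]
      refine lintegral_mono fun w => ?_
      by_cases h3 : ∀ j < m + 1, w j ≠ y
      · simp only [if_pos h3]
        refine (hg (w m) (h3 m (by omega))).trans (le_of_eq ?_)
        congr 1
        refine lintegral_congr fun z => ?_
        rw [if_pos]
        exact fun j hj => h3 j hj
      · rw [if_neg h3]
        exact zero_le
  refine (key m).trans ?_
  gcongr
  refine mul_le_of_le_one_right' ?_
  calc ∫⁻ w, (if ∀ j < m, w j ≠ y then g (w m) else 0) ∂μ ≤ ∫⁻ _, 1 ∂μ := by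
        refine lintegral_mono fun w => ?_
        dsimp only
        split_ifs
        exacts [hg1 _, zero_le]
    _ = 1 := by simp [hμ]

end Walk

/-! ### Hitting probabilities -/

section Hitting

/-- The function `h ^ dist · y` is subharmonic away from `y` for the walk killed at rate `1 - p`,
if `h` satisfies the quadratic equation `h (b + 1) = p (1 + b h ^ 2)`. -/
lemma pow_dist_le_lintegral_stepLaw [MeasurableSpace V] [DiscreteMeasurableSpace V] [Countable V]
    (G : SimpleGraph V) [G.LocallyFinite] (hG : G.Connected) {b : ℕ}
    (hreg : G.IsRegularOfDegree (b + 1)) {h p : ℝ} (h0 : 0 ≤ h) (h1 : h ≤ 1) (p0 : 0 ≤ p)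
    (hp : h * (b + 1) = p * (1 + b * h ^ 2)) {v y : V} (hv : v ≠ y) :
    ENNReal.ofReal (h ^ G.dist v y) ≤
      ENNReal.ofReal p * ∫⁻ z, ENNReal.ofReal (h ^ G.dist z y) ∂stepLaw G v := by
  classical
  obtain ⟨w, hw⟩ := hG.exists_walk_length_eq_dist v y
  obtain ⟨k, hk⟩ : ∃ k, G.dist v y = k + 1 :=
    Nat.exists_eq_succ_of_ne_zero fun h => hv (hG.dist_eq_zero_iff.1 h)
  have hnil : ¬ w.Nil := by
    rw [← SimpleGraph.Walk.length_eq_zero_iff]; omega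
  have hadj := w.adj_snd hnil
  have hsnd : G.dist w.snd y ≤ k := by
    refine (SimpleGraph.dist_le w.tail).trans ?_
    have := w.length_tail_add_one hnil
    omega
  -- One neighbour lies on a geodesic to `y`; the `b` others are at distance at most `k + 2`. As `h
  -- ≤ 1`, upper bounds on distances suffice.
  have hother : ∀ z ∈ (G.neighborFinset v).erase w.snd, h ^ (k + 2) ≤ h ^ G.dist z y := by
    intro z hz
    have hz' : G.Adj v z := (G.mem_neighborFinset _ _).1 (Finset.mem_of_mem_erase hz)
    refine pow_le_pow_of_le_one h0 h1 ?_
    refine (hG.dist_triangle (v := v)).trans ?_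
    rw [SimpleGraph.dist_eq_one_iff_adj.2 hz'.symm]; omega
  have hmem : w.snd ∈ G.neighborFinset v := (G.mem_neighborFinset _ _).2 hadj
  have hsum : h ^ k + b * h ^ (k + 2) ≤ ∑ z ∈ G.neighborFinset v, h ^ G.dist z y := by
    rw [← Finset.add_sum_erase _ _ hmem]
    refine add_le_add (pow_le_pow_of_le_one h0 h1 hsnd) ?_
    have := Finset.card_nsmul_le_sum _ _ _ hother
    rwa [Finset.card_erase_of_mem hmem, SimpleGraph.card_neighborFinset_eq_degree, hreg v,
      Nat.add_sub_cancel, nsmul_eq_mul] at this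
  rw [lintegral_stepLaw G (Nat.succ_pos b) hreg, ← ENNReal.ofReal_sum_of_nonneg
    (fun _ _ => pow_nonneg h0 _), ← ENNReal.ofReal_natCast, ← ENNReal.ofReal_inv_of_pos
    (by positivity), ← ENNReal.ofReal_mul (by positivity), ← ENNReal.ofReal_mul p0, hk]
  refine ENNReal.ofReal_le_ofReal ?_
  have hb : (0 : ℝ) < b + 1 := by positivity
  calc h ^ (k + 1) = p * ((b + 1 : ℝ)⁻¹ * (h ^ k + b * h ^ (k + 2))) := by
        have : p * ((b + 1 : ℝ)⁻¹ * (h ^ k + b * h ^ (k + 2))) =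
          (p * (1 + b * h ^ 2)) * h ^ k * (b + 1 : ℝ)⁻¹ := by ring
        rw [this, ← hp]
        field_simp
        ring
    _ ≤ _ := by
        push_cast
        gcongr

end Hitting

/-! ### Lifetimes -/

/-- This identifies discounting by `p` per step with being alive at time `m`. -/
lemma lifetimeLaw_lt (p : I) (hp : p < 1) (m : ℕ) :
    lifetimeLaw p {k | (m : ℕ∞) < k} = ENNReal.ofReal p ^ m := by
  have hσ : σ p ≠ 0 := by
    intro h
    rw [unitInterval.symm_eq_zero] at h
    exact hp.ne h
  have hp' : (1 : ℝ) - (σ p : I) = p := by simp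
  have hset : (fun n : ℕ => ((n + 1 : ℕ) : ℕ∞)) ⁻¹' {k | (m : ℕ∞) < k} =
      ((Finset.range m : Set ℕ))ᶜ := by
    ext n
    simp only [Set.mem_preimage, Set.mem_ofPred_eq, Nat.cast_lt, Set.mem_compl_iff, Finset.mem_coe,
      Finset.mem_range]
    omega
  rw [lifetimeLaw, if_neg hp.ne, Measure.map_apply Measurable.of_discrete MeasurableSet.of_discrete,
    hset, prob_compl_eq_one_sub (Finset.measurableSet _), ← sum_measure_singleton]
  simp_rw [geometricMeasure_singleton hσ, hp']
  rw [← ENNReal.ofReal_sum_of_nonneg, ← Finset.sum_mul, ← ENNReal.ofReal_one,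
    ← ENNReal.ofReal_sub, ← ENNReal.ofReal_pow p.2.1]
  · congr 1
    have := geom_sum_mul (p : ℝ) m
    rw [unitInterval.coe_symm_eq]
    linarith
  · exact mul_nonneg (Finset.sum_nonneg fun _ _ => pow_nonneg p.2.1 _) (σ p).2.1
  · exact fun _ _ => mul_nonneg (pow_nonneg p.2.1 _) (σ p).2.1

/-! ### The randomness attached to a site -/

section Site

/-- The initial number of particles at `x`, with the trajectory and the lifetime of the first
one. -/
def site (x : V) (ω : Config V) : ℕ × (ℕ → V) × ℕ∞ := (ω.1 x, ω.2.1 (x, 0), ω.2.2 (x, 0))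

/-- The values of `site x` for which the first particle is present and visits `y`. -/
def reachSet (y : V) : Set (ℕ × (ℕ → V) × ℕ∞) :=
  {u | 1 ≤ u.1 ∧ ∃ n : ℕ, (n : ℕ∞) < u.2.2 ∧ u.2.1 n = y}

/-- The product sets in the range of `site`. -/
def boxes (V : Type*) [MeasurableSpace V] : Set (Set (ℕ × (ℕ → V) × ℕ∞)) :=
  Set.image2 (· ×ˢ ·) {A : Set ℕ | MeasurableSet A}
    (Set.image2 (· ×ˢ ·) {B : Set (ℕ → V) | MeasurableSet B} {C : Set ℕ∞ | MeasurableSet C})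

lemma isPiSystem_boxes [MeasurableSpace V] : IsPiSystem (boxes V) :=
  MeasurableSpace.isPiSystem_measurableSet.prod
    (MeasurableSpace.isPiSystem_measurableSet.prod MeasurableSpace.isPiSystem_measurableSet)

lemma generateFrom_boxes [MeasurableSpace V] :
    MeasurableSpace.generateFrom (boxes V) =
      (inferInstance : MeasurableSpace (ℕ × (ℕ → V) × ℕ∞)) :=
  generateFrom_eq_prod MeasurableSpace.generateFrom_measurableSet
    (generateFrom_eq_prod MeasurableSpace.generateFrom_measurableSet
      MeasurableSpace.generateFrom_measurableSet isCountablySpanning_measurableSet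
      isCountablySpanning_measurableSet) isCountablySpanning_measurableSet
    (isCountablySpanning_measurableSet.prod isCountablySpanning_measurableSet)

lemma measurable_site [MeasurableSpace V] (x : V) : Measurable (site x) := by
  unfold site
  fun_prop

lemma measurableSet_reachSet [MeasurableSpace V] [MeasurableSingletonClass V] (y : V) :
    MeasurableSet (reachSet y) := by
  have : reachSet y = Prod.fst ⁻¹' Set.Ici 1 ∩ ⋃ n : ℕ,
      ((fun u : ℕ × (ℕ → V) × ℕ∞ => u.2.2) ⁻¹' Set.Ioi (n : ℕ∞) ∩
        (fun u : ℕ × (ℕ → V) × ℕ∞ => u.2.1 n) ⁻¹' {y}) := by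
    ext u; simp [reachSet]
  rw [this]
  refine (measurable_fst measurableSet_Ici).inter (MeasurableSet.iUnion fun n => ?_)
  have h1 : Measurable (fun u : ℕ × (ℕ → V) × ℕ∞ => u.2.2) := by fun_prop
  have h2 : Measurable (fun u : ℕ × (ℕ → V) × ℕ∞ => u.2.1 n) := by fun_prop
  exact (h1 MeasurableSet.of_discrete).inter (h2 (measurableSet_singleton y))

variable [MeasurableSpace V] [DiscreteMeasurableSpace V] (G : SimpleGraph V) [G.LocallyFinite]
  (p : I) (η : Measure ℕ) [IsProbabilityMeasure η]

instance : IsProbabilityMeasure (law G p η) := by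
  unfold law
  infer_instance

lemma law_iInter_boxes (s : Finset V) {A : V → Set ℕ} {B : V → Set (ℕ → V)} {C : V → Set ℕ∞}
    (hA : ∀ x, MeasurableSet (A x)) (hB : ∀ x, MeasurableSet (B x))
    (hC : ∀ x, MeasurableSet (C x)) :
    law G p η (⋂ x ∈ s, site x ⁻¹' (A x ×ˢ B x ×ˢ C x)) =
      ∏ x ∈ s, (η (A x) * (srwLaw G x (B x) * lifetimeLaw p (C x))) := by
  classical
  -- Only the particle numbered `0` at each site enters.
  set s' : Finset (V × ℕ) := s.map ⟨fun x => (x, 0), fun x y h => congrArg Prod.fst h⟩ with hs'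
  have hset : (⋂ x ∈ s, site x ⁻¹' (A x ×ˢ B x ×ˢ C x)) =
      ((s : Set V).pi A) ×ˢ (((s' : Set (V × ℕ)).pi fun a => B a.1) ×ˢ
        ((s' : Set (V × ℕ)).pi fun a => C a.1)) := by
    ext ω
    simp only [Set.mem_iInter, Set.mem_preimage, site, Set.mem_prod, Set.mem_pi, Finset.mem_coe,
      hs', Finset.mem_map, forall_exists_index, and_imp,
      forall_apply_eq_imp_iff₂]
    exact ⟨fun h => ⟨fun x hx => (h x hx).1, fun x hx => (h x hx).2.1, fun x hx => (h x hx).2.2⟩,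
      fun h x hx => ⟨h.1 x hx, h.2.1 x hx, h.2.2 x hx⟩⟩
  rw [hset, law, Measure.prod_prod, Measure.prod_prod, Measure.infinitePi_pi _ fun x _ => hA x,
    Measure.infinitePi_pi _ fun a _ => hB a.1, Measure.infinitePi_pi _ fun a _ => hC a.1, hs',
    Finset.prod_map, Finset.prod_map, Finset.prod_mul_distrib, Finset.prod_mul_distrib]
  rfl

lemma law_box (x : V) {A : Set ℕ} {B : Set (ℕ → V)} {C : Set ℕ∞}
    (hA : MeasurableSet A) (hB : MeasurableSet B) (hC : MeasurableSet C) :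
    law G p η (site x ⁻¹' (A ×ˢ B ×ˢ C)) = η A * (srwLaw G x B * lifetimeLaw p C) := by
  simpa using law_iInter_boxes G p η {x} (A := fun _ => A) (B := fun _ => B) (C := fun _ => C)
    (fun _ => hA) (fun _ => hB) (fun _ => hC)

/-- The randomness attached to different sites is independent. -/
lemma iIndep_site : iIndep (fun x : V => MeasurableSpace.comap (site x) inferInstance)
    (law G p η) := by
  refine iIndepSets.iIndep (fun x => (measurable_site x).comap_le)
    (fun x => {S | ∃ T ∈ boxes V, site x ⁻¹' T = S}) (fun x => isPiSystem_boxes.comap (site x))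
    (fun x => ?_) ?_
  · rw [← generateFrom_boxes, MeasurableSpace.comap_generateFrom]
    rfl
  · rw [iIndepSets_iff]
    intro s f hf
    have hf' : ∀ x : V, ∃ (A : Set ℕ) (B : Set (ℕ → V)) (C : Set ℕ∞), MeasurableSet A ∧
        MeasurableSet B ∧ MeasurableSet C ∧ (x ∈ s → f x = site x ⁻¹' (A ×ˢ B ×ˢ C)) := by
      intro x
      by_cases hx : x ∈ s
      · obtain ⟨T, ⟨A, hA, D, ⟨B, hB, C, hC, rfl⟩, rfl⟩, hT⟩ := hf x hx
        exact ⟨A, B, C, hA, hB, hC, fun _ => hT.symm⟩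
      · exact ⟨∅, ∅, ∅, .empty, .empty, .empty, fun h => absurd h hx⟩
    choose A B C hA hB hC hfeq using hf'
    rw [Set.iInter₂_congr hfeq, law_iInter_boxes G p η s hA hB hC]
    refine Finset.prod_congr rfl fun x hx => ?_
    rw [hfeq x hx, law_box G p η x (hA x) (hB x) (hC x)]

lemma ae_nearestNeighbour [Countable V] {d : ℕ} (hd : 0 < d) (hreg : G.IsRegularOfDegree d) :
    ∀ᵐ ω ∂law G p η, NearestNeighbour G ω := by
  simp only [NearestNeighbour, ae_all_iff]
  intro x i
  have h : ∀ᵐ w ∂srwLaw G x, w 0 = x ∧ ∀ n, G.Adj (w n) (w (n + 1)) :=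
    (ae_srwLaw_zero G x).and (ae_srwLaw_adj G hd hreg x)
  have h1 : MeasurePreserving (fun f : V × ℕ → ℕ → V => f (x, i))
      (Measure.infinitePi fun a : V × ℕ => srwLaw G a.1) (srwLaw G x) :=
    measurePreserving_eval_infinitePi (fun a : V × ℕ => srwLaw G a.1) (x, i)
  have h2 : MeasurePreserving (fun ω : Config V => ω.2.1 (x, i)) (law G p η) (srwLaw G x) :=
    h1.comp (measurePreserving_fst.comp measurePreserving_snd)
  exact h2.quasiMeasurePreserving.ae h

/-- A particle reaches a vertex at distance `k` with probability at least `q h ^ k`, where `q` is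
the probability that there is a particle. -/
lemma law_reaches_ge [Countable V] (hG : G.Connected) {b : ℕ}
    (hreg : G.IsRegularOfDegree (b + 1)) {h : ℝ} (h0 : 0 ≤ h) (h1 : h ≤ 1) (hp1 : p < 1)
    (hp : h * (b + 1) = p * (1 + b * h ^ 2)) (x y : V) :
    η {n | 1 ≤ n} * ENNReal.ofReal (h ^ G.dist x y) ≤ law G p η {ω | Reaches ω x y} := by
  set P := ENNReal.ofReal p with hP
  have hP1 : P < 1 := by
    rw [hP, ENNReal.ofReal_lt_one]; exact hp1
  have hbound : ∀ m, η {n | 1 ≤ n} * ENNReal.ofReal (h ^ G.dist x y) ≤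
      law G p η {ω | Reaches ω x y} + P ^ m := by
    intro m
    have hle := le_sum_firstHit G x y P hP1.le (fun v => ENNReal.ofReal (h ^ G.dist v y))
      (fun v => ENNReal.ofReal_le_one.2 (pow_le_one₀ h0 h1))
      (fun v hv => pow_dist_le_lintegral_stepLaw G hG hreg h0 h1 p.2.1 hp hv) m
    refine (mul_le_mul_right hle _).trans ?_
    rw [mul_add]
    refine add_le_add ?_ (mul_le_of_le_one_left' prob_le_one)
    rw [Finset.mul_sum]
    have hmeas : ∀ j : ℕ, MeasurableSet ({n : ℕ | 1 ≤ n} ×ˢ firstHit y j ×ˢ {k | (j : ℕ∞) < k}) :=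
      fun j => MeasurableSet.of_discrete.prod ((measurableSet_firstHit y j).prod
        MeasurableSet.of_discrete)
    -- The `j`-th term is the probability that a particle is present, first visits the target at
    -- time `j` and is then alive. These events are disjoint in `j`.
    have hterm : ∀ j : ℕ, η {n | 1 ≤ n} * (P ^ j * srwLaw G x (firstHit y j)) =
        law G p η (site x ⁻¹' ({n | 1 ≤ n} ×ˢ firstHit y j ×ˢ {k | (j : ℕ∞) < k})) := by
      intro j
      rw [law_box G p η x MeasurableSet.of_discrete (measurableSet_firstHit y j)
        MeasurableSet.of_discrete, lifetimeLaw_lt p hp1 j, mul_comm (P ^ j)]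
    rw [Finset.sum_congr rfl fun j _ => hterm j, ← measure_biUnion_finset]
    · refine measure_mono (Set.iUnion₂_subset fun j _ ω hω => ?_)
      exact ⟨hω.1, j, hω.2.2, hω.2.1.1⟩
    · intro i _ j _ hij
      refine Set.disjoint_left.2 fun ω hi hj => ?_
      rcases lt_or_gt_of_ne hij with hlt | hlt
      · exact hj.2.1.2 i hlt hi.2.1.1
      · exact hi.2.1.2 j hlt hj.2.1.1
    · exact fun j _ => measurable_site x (hmeas j)
  have hlim : Filter.Tendsto (fun m => law G p η {ω | Reaches ω x y} + P ^ m) Filter.atTop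
      (nhds (law G p η {ω | Reaches ω x y} + 0)) :=
    (ENNReal.tendsto_pow_atTop_nhds_zero_of_lt_one hP1).const_add _
  rw [add_zero] at hlim
  exact ge_of_tendsto' hlim hbound

end Site

/-! ### Independent coverage of a ray, and one step of the branching argument -/

section Independence

variable {Ω ι : Type*} {mΩ : MeasurableSpace Ω} {μ : Measure Ω} {m : ι → MeasurableSpace Ω}

lemma measureReal_inter_of_disjoint (hm : ∀ i, m i ≤ mΩ) (hind : iIndep m μ) {S T : Set ι}
    (hST : Disjoint S T) {A B : Set Ω} (hA : MeasurableSet[⨆ i ∈ S, m i] A)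
    (hB : MeasurableSet[⨆ i ∈ T, m i] B) : μ.real (A ∩ B) = μ.real A * μ.real B := by
  have h := (Indep_iff _ _ μ).1 (indep_iSup_of_disjoint hm hind hST) A B hA hB
  simp only [measureReal_def, h, ENNReal.toReal_mul]

lemma measurableSet_iSup_mono {S T : Set ι} (hST : S ⊆ T) {A : Set Ω}
    (hA : MeasurableSet[⨆ i ∈ S, m i] A) : MeasurableSet[⨆ i ∈ T, m i] A :=
  (biSup_mono hST : (⨆ i ∈ S, m i) ≤ ⨆ i ∈ T, m i) A hA

lemma measurableSet_iSup_of_mem {S : Set ι} {i : ι} (hi : i ∈ S) {A : Set Ω}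
    (hA : MeasurableSet[m i] A) : MeasurableSet[⨆ i ∈ S, m i] A :=
  (le_biSup m hi : m i ≤ ⨆ i ∈ S, m i) A hA

end Independence

section Coverage

variable {Ω : Type*}

/-- Each of the first `n` edges of the half-line is crossed, where `A i k` is the event that the
particle starting from `i` gets to `k`. -/
def cover (A : ℕ → ℕ → Set Ω) (n : ℕ) : Set Ω := ⋂ j < n, ⋃ i ≤ j, A i (j + 1)

/-- The first `n` edges are crossed, and one of the particles from `0, …, n` gets to `n + k`. -/
def coverReach (A : ℕ → ℕ → Set Ω) (n k : ℕ) : Set Ω := cover A n ∩ ⋃ i ≤ n, A i (n + k)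

lemma cover_succ (A : ℕ → ℕ → Set Ω) (n : ℕ) : cover A (n + 1) = coverReach A n 1 := by
  simp only [cover, coverReach]
  ext ω
  simp only [Set.mem_iInter, Set.mem_inter_iff]
  refine ⟨fun h => ⟨fun j hj => h j (by omega), h n (by omega)⟩, fun h j hj => ?_⟩
  rcases Nat.lt_succ_iff_lt_or_eq.1 hj with hj | rfl
  exacts [h.1 j hj, h.2]

/-- Either an earlier particle gets to `n + 1 + k`, and then it has crossed the next edge on the
way, or the particle from `n + 1` does, and the next edge must be crossed separately. -/
lemma coverReach_succ {A : ℕ → ℕ → Set Ω} (hA : ∀ i, Antitone (A i)) (n k : ℕ) :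
    coverReach A (n + 1) k =
      coverReach A n (k + 1) ∪ (coverReach A n 1 ∩ A (n + 1) (n + 1 + k)) := by
  have h1 : (⋃ i ≤ n + 1, A i (n + 1 + k)) =
      (⋃ i ≤ n, A i (n + (k + 1))) ∪ A (n + 1) (n + 1 + k) := by
    ext ω
    simp only [Set.mem_iUnion, Set.mem_union, exists_prop, show n + (k + 1) = n + 1 + k by ring]
    constructor
    · rintro ⟨i, hi, h⟩
      rcases Nat.le_succ_iff.1 hi with hi | rfl
      exacts [Or.inl ⟨i, hi, h⟩, Or.inr h]
    · rintro (⟨i, hi, h⟩ | h)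
      exacts [⟨i, by omega, h⟩, ⟨n + 1, le_rfl, h⟩]
  have h2 : (⋃ i ≤ n, A i (n + (k + 1))) ⊆ ⋃ i ≤ n, A i (n + 1) :=
    Set.iUnion₂_mono fun i _ => hA i (by omega)
  rw [coverReach, cover_succ, h1, Set.inter_union_distrib_left]
  congr 1
  rw [coverReach, coverReach, Set.inter_assoc, Set.inter_eq_right.2 h2]

lemma coverReach_subset {A : ℕ → ℕ → Set Ω} (hA : ∀ i, Antitone (A i)) (n k : ℕ) :
    coverReach A n (k + 1) ⊆ coverReach A n 1 :=
  Set.inter_subset_inter_right _ (Set.iUnion₂_mono fun i _ => hA i (by omega))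

lemma measurableSet_cover {mΩ : MeasurableSpace Ω} {A : ℕ → ℕ → Set Ω} {n : ℕ}
    (hA : ∀ i < n, ∀ k, MeasurableSet (A i k)) : MeasurableSet (cover A n) := by
  refine MeasurableSet.biInter (Set.to_countable {j | j < n}) fun j hj => ?_
  refine MeasurableSet.biUnion (Set.to_countable {i | i ≤ j}) fun i hi => ?_
  exact hA i (lt_of_le_of_lt hi hj) _

lemma measurableSet_coverReach {mΩ : MeasurableSpace Ω} {A : ℕ → ℕ → Set Ω} {n : ℕ}
    (hA : ∀ i ≤ n, ∀ k, MeasurableSet (A i k)) (k : ℕ) : MeasurableSet (coverReach A n k) := by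
  refine (measurableSet_cover fun i hi => hA i hi.le).inter ?_
  exact MeasurableSet.biUnion (Set.to_countable {i | i ≤ n}) fun i hi => hA i hi _

variable {mΩ : MeasurableSpace Ω} {μ : Measure Ω} [IsProbabilityMeasure μ]
  {m : ℕ → MeasurableSpace Ω}

/-- If particles start independently from the vertices of the half-line and get to distance `k`
with probability at least `q h ^ k`, then joint coverage decays at a rate better than `h`. -/
lemma le_measureReal_coverReach (hm : ∀ i, m i ≤ mΩ) (hind : iIndep m μ) {A : ℕ → ℕ → Set Ω}
    (hA : ∀ i, Antitone (A i)) (hAm : ∀ i k, MeasurableSet[m i] (A i k)) {q h : ℝ} (q0 : 0 ≤ q)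
    (h0 : 0 ≤ h) (h1 : h ≤ 1) (hqA : ∀ i k, q * h ^ k ≤ μ.real (A i (i + k))) (n : ℕ) :
    ∀ k, 1 ≤ k → q * h ^ (n + k) * (1 + q * (1 - h)) ^ n ≤ μ.real (coverReach A n k) := by
  induction n with
  | zero =>
    intro k _
    have : coverReach A 0 k = A 0 (0 + k) := by
      ext ω; simp [coverReach, cover]
    rw [this]
    simpa using hqA 0 k
  | succ n ih =>
    intro k hk
    set c := q * h ^ n * (1 + q * (1 - h)) ^ n with hc
    have hc0 : 0 ≤ c := by
      have : 0 ≤ 1 - h := by linarith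
      positivity
    have hBm : ∀ k, MeasurableSet[⨆ i ∈ Set.Iic n, m i] (coverReach A n k) := fun k =>
      measurableSet_coverReach
        (fun i hi l => measurableSet_iSup_of_mem (Set.mem_Iic.2 hi) (hAm i l)) k
    have hAm' : MeasurableSet[⨆ i ∈ ({n + 1} : Set ℕ), m i] (A (n + 1) (n + 1 + k)) :=
      measurableSet_iSup_of_mem (Set.mem_singleton _) (hAm _ _)
    have hdisj : Disjoint (Set.Iic n) ({n + 1} : Set ℕ) := by simp
    have hle : ∀ S : Set ℕ, (⨆ i ∈ S, m i) ≤ mΩ := fun S => iSup₂_le fun i _ => hm i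
    have hA1 : MeasurableSet (A (n + 1) (n + 1 + k)) := hm _ _ (hAm _ _)
    have hB1 : ∀ k, MeasurableSet (coverReach A n k) := fun k => hle _ _ (hBm k)
    set a := μ.real (A (n + 1) (n + 1 + k)) with ha
    set β := μ.real (coverReach A n (k + 1)) with hβ
    set β₁ := μ.real (coverReach A n 1) with hβ₁
    have hsub := coverReach_subset hA n k
    -- The particle from `n + 1` is independent of the earlier ones and adds mass only where they
    -- cross the next edge but fall short of the target.
    have hunion : μ.real (coverReach A (n + 1) k) = β + a * (β₁ - β) := by
      have hu : coverReach A (n + 1) k = coverReach A n (k + 1) ∪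
          ((coverReach A n 1 \ coverReach A n (k + 1)) ∩ A (n + 1) (n + 1 + k)) := by
        rw [coverReach_succ hA]
        ext ω
        simp only [Set.mem_union, Set.mem_inter_iff, Set.mem_sdiff]
        tauto
      rw [hu, measureReal_union (Set.disjoint_left.2 fun ω h h' => h'.1.2 h)
        (((hB1 1).diff (hB1 _)).inter hA1), measureReal_inter_of_disjoint hm hind hdisj
        (MeasurableSet.diff (hBm 1) (hBm _)) hAm', measureReal_sdiff hsub (hB1 _)]
      ring
    have ha1 : a ≤ 1 := measureReal_le_one
    have haq : q * h ^ k ≤ a := hqA (n + 1) k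
    have hββ : β ≤ β₁ := measureReal_mono hsub
    have ih1 : c * h ≤ β₁ := by
      refine le_trans (le_of_eq ?_) (ih 1 le_rfl)
      rw [hc]; ring
    have ihk : c * h ^ (k + 1) ≤ β := by
      refine le_trans (le_of_eq ?_) (ih (k + 1) (by omega))
      rw [hc]; ring
    have hhk : h ^ k ≤ h := pow_le_of_le_one h0 h1 (by omega)
    have hhk0 : 0 ≤ h ^ k := pow_nonneg h0 k
    have hqk : q * h ^ k ≤ 1 := haq.trans ha1
    rw [hunion]
    calc q * h ^ (n + 1 + k) * (1 + q * (1 - h)) ^ (n + 1)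
        = c * h ^ (k + 1) * (1 + q * (1 - h)) := by rw [hc]; ring
      -- Here `1 ≤ k` is essential: for `k = 0` the factor would bring no gain.
      _ ≤ c * h ^ (k + 1) * (1 + q * (1 - h ^ k)) := by
          gcongr
      _ = c * h ^ (k + 1) * (1 - q * h ^ k) + q * h ^ k * (c * h) := by ring
      _ ≤ β * (1 - q * h ^ k) + q * h ^ k * β₁ := by
          have : 0 ≤ 1 - q * h ^ k := by linarith
          gcongr
      _ = β + q * h ^ k * (β₁ - β) := by ring
      _ ≤ β + a * (β₁ - β) := by
          have : 0 ≤ β₁ - β := by linarith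
          gcongr

end Coverage

/-! ### Comparison with a supercritical branching process -/

section Branching

/-- A weak second-order Bonferroni bound: one of `n` independent events of probability `θ` occurs
with probability at least `n θ (1 - n θ)`. -/
lemma one_sub_pow_le {θ : ℝ} (h0 : 0 ≤ θ) (h1 : θ ≤ 1) (n : ℕ) :
    (1 - θ) ^ n ≤ 1 - n * θ * (1 - n * θ) := by
  induction n with
  | zero => simp
  | succ n ih =>
    calc (1 - θ) ^ (n + 1) = (1 - θ) ^ n * (1 - θ) := pow_succ _ _
      _ ≤ (1 - n * θ * (1 - n * θ)) * (1 - θ) := by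
          gcongr
      _ ≤ _ := by
          push_cast
          have hn : (0 : ℝ) ≤ n := Nat.cast_nonneg n
          have h3 : 0 ≤ (n : ℝ) ^ 2 * θ ^ 3 := by positivity
          have h4 : 0 ≤ (n : ℝ) * θ ^ 2 := by positivity
          nlinarith [sq_nonneg θ]

variable {Ω ι W : Type*} {mΩ : MeasurableSpace Ω} {μ : Measure Ω} [IsProbabilityMeasure μ]
  {m : ι → MeasurableSpace Ω}

lemma measureReal_inter_biInter_compl (hm : ∀ i, m i ≤ mΩ) (hind : iIndep m μ) {S₀ : Set ι}
    {S : W → Set ι} (hS₀ : ∀ w, Disjoint S₀ (S w)) (hS : Pairwise (Function.onFun Disjoint S))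
    {F : Set Ω} {E : W → Set Ω} (hF : MeasurableSet[⨆ i ∈ S₀, m i] F)
    (hE : ∀ w, MeasurableSet[⨆ i ∈ S w, m i] (E w)) (s : Finset W) :
    μ.real (F ∩ ⋂ w ∈ s, (E w)ᶜ) = μ.real F * ∏ w ∈ s, (1 - μ.real (E w)) := by
  classical
  induction s using Finset.induction_on with
  | empty => simp
  | insert w s hw ih =>
    have hset : F ∩ ⋂ v ∈ insert w s, (E v)ᶜ = (F ∩ ⋂ v ∈ s, (E v)ᶜ) ∩ (E w)ᶜ := by
      rw [Finset.set_biInter_insert, Set.inter_comm ((E w)ᶜ), Set.inter_assoc]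
    have hle : ∀ S : Set ι, (⨆ i ∈ S, m i) ≤ mΩ := fun S => iSup₂_le fun i _ => hm i
    have hmeas : MeasurableSet[⨆ i ∈ S₀ ∪ ⋃ v ∈ s, S v, m i] (F ∩ ⋂ v ∈ s, (E v)ᶜ) := by
      refine MeasurableSet.inter (measurableSet_iSup_mono Set.subset_union_left hF) ?_
      refine Finset.measurableSet_biInter s fun v hv => MeasurableSet.compl ?_
      refine measurableSet_iSup_mono ?_ (hE v)
      exact (Set.subset_biUnion_of_mem (u := fun v => S v) hv).trans Set.subset_union_right
    have hdisj : Disjoint (S₀ ∪ ⋃ v ∈ s, S v) (S w) := by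
      rw [Set.disjoint_union_left, Set.disjoint_iUnion₂_left]
      exact ⟨hS₀ w, fun v hv => hS fun h => hw (h ▸ hv)⟩
    rw [hset, measureReal_inter_of_disjoint hm hind hdisj hmeas (MeasurableSet.compl (hE w)), ih,
      Finset.prod_insert hw, probReal_compl_eq_one_sub (hle _ _ (hE w))]
    ring

/-- One step of the comparison with a supercritical branching process: if the mean number of good
children is at least `M` and each of them independently survives with probability at least `θ`,
then some good child survives with probability at least `θ`, provided that `θ` is small. -/
lemma le_measureReal_exists_good [Fintype W] (hm : ∀ i, m i ≤ mΩ) (hind : iIndep m μ) {S₀ : Set ι}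
    {S : W → Set ι} (hS₀ : ∀ w, Disjoint S₀ (S w)) (hS : Pairwise (Function.onFun Disjoint S))
    {F E : W → Set Ω} (hF : ∀ w, MeasurableSet[⨆ i ∈ S₀, m i] (F w))
    (hE : ∀ w, MeasurableSet[⨆ i ∈ S w, m i] (E w)) {θ M : ℝ} (θ0 : 0 ≤ θ)
    (hθE : ∀ w, θ ≤ μ.real (E w)) (hM : M ≤ ∑ w, μ.real (F w)) (θ1 : θ ≤ 1)
    (hθ : Fintype.card W * θ ≤ 1) (hMθ : 1 ≤ M * (1 - Fintype.card W * θ)) :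
    θ ≤ μ.real (⋃ w, F w ∩ E w) := by
  classical
  -- The events `F w` may be dependent, so the space is partitioned by the exact set `s` of good
  -- children; given `s`, the events `E w` are still independent.
  set g : Finset W → Set Ω := fun s => ⋂ w, if w ∈ s then F w else (F w)ᶜ with hg
  have hmem : ∀ s ω, ω ∈ g s ↔ ∀ w, ω ∈ F w ↔ w ∈ s := by
    intro s ω
    simp only [hg, Set.mem_iInter]
    refine forall_congr' fun w => ?_
    by_cases h : w ∈ s <;> simp [h]
  have hle : ∀ S : Set ι, (⨆ i ∈ S, m i) ≤ mΩ := fun S => iSup₂_le fun i _ => hm i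
  have hgm : ∀ s, MeasurableSet[⨆ i ∈ S₀, m i] (g s) := by
    intro s
    refine MeasurableSet.iInter fun w => ?_
    split_ifs
    exacts [hF w, MeasurableSet.compl (hF w)]
  set u : Finset W → Set Ω := fun s => g s \ ⋂ w ∈ s, (E w)ᶜ with hu
  have hcm : ∀ s : Finset W, MeasurableSet (⋂ w ∈ s, (E w)ᶜ) := fun s =>
    Finset.measurableSet_biInter s fun w _ => (hle _ _ (hE w)).compl
  have hgdisj : ∀ s t ω, ω ∈ g s → ω ∈ g t → s = t := by
    intro s t ω hs ht
    ext w
    rw [← (hmem s ω).1 hs w, (hmem t ω).1 ht w]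
  have hsub : (⋃ s ∈ (Finset.univ : Finset (Finset W)), u s) ⊆ ⋃ w, F w ∩ E w := by
    refine Set.iUnion₂_subset fun s _ ω hω => ?_
    obtain ⟨h1, h2⟩ := hω
    simp only [Set.mem_iInter, Set.mem_compl_iff, not_forall, not_not] at h2
    obtain ⟨w, hw, hωw⟩ := h2
    exact Set.mem_iUnion.2 ⟨w, ((hmem s ω).1 h1 w).2 hw, hωw⟩
  have hterm : ∀ s : Finset W,
      μ.real (g s) * (s.card * (θ * (1 - Fintype.card W * θ))) ≤ μ.real (u s) := by
    intro s
    have hsplit := measureReal_inter_add_sdiff (μ := μ) (s := g s) (hcm s)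
    rw [measureReal_inter_biInter_compl hm hind hS₀ hS (hgm s) hE s] at hsplit
    have hprod : ∏ w ∈ s, (1 - μ.real (E w)) ≤ (1 - θ) ^ s.card := by
      rw [← Finset.prod_const]
      refine Finset.prod_le_prod (fun w _ => ?_) fun w _ => ?_
      · linarith [measureReal_le_one (μ := μ) (s := E w)]
      · linarith [hθE w]
    have hpow := one_sub_pow_le θ0 θ1 s.card
    have hcard : (s.card : ℝ) ≤ Fintype.card W := by exact_mod_cast s.card_le_univ
    -- Bounding one factor `s.card` by `Fintype.card W` makes the estimate linear in `s.card`, so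
    -- that only the mean number of good children matters.
    have hbd : s.card * (θ * (1 - Fintype.card W * θ)) ≤ 1 - ∏ w ∈ s, (1 - μ.real (E w)) := by
      have : s.card * (θ * (1 - Fintype.card W * θ)) ≤ s.card * (θ * (1 - s.card * θ)) := by
        gcongr
      nlinarith
    have hg0 : 0 ≤ μ.real (g s) := measureReal_nonneg
    have := mul_le_mul_of_nonneg_left hbd hg0
    linarith
  have hcount : M ≤ ∑ s : Finset W, μ.real (g s) * s.card := by
    refine hM.trans ?_
    have h1 : ∀ w, μ.real (F w) ≤ ∑ s : Finset W, if w ∈ s then μ.real (g s) else 0 := by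
      intro w
      rw [← Finset.sum_filter]
      refine le_trans (measureReal_mono ?_ (measure_ne_top μ _)) (measureReal_biUnion_finset_le _ _)
      intro ω hω
      refine Set.mem_iUnion₂.2 ⟨Finset.univ.filter (fun v => ω ∈ F v), by simp [hω], ?_⟩
      rw [hmem]
      simp
    refine (Finset.sum_le_sum fun w _ => h1 w).trans (le_of_eq ?_)
    rw [Finset.sum_comm]
    refine Finset.sum_congr rfl fun s _ => ?_
    rw [← Finset.sum_filter, Finset.sum_const, nsmul_eq_mul, mul_comm]
    simp
  have hθ' : 0 ≤ 1 - Fintype.card W * θ := by linarith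
  calc θ ≤ θ * (M * (1 - Fintype.card W * θ)) := le_mul_of_one_le_right θ0 hMθ
    _ = M * (θ * (1 - Fintype.card W * θ)) := by ring
    _ ≤ (∑ s : Finset W, μ.real (g s) * s.card) * (θ * (1 - Fintype.card W * θ)) := by gcongr
    _ = ∑ s : Finset W, μ.real (g s) * (s.card * (θ * (1 - Fintype.card W * θ))) := by
        rw [Finset.sum_mul]
        exact Finset.sum_congr rfl fun s _ => by ring
    _ ≤ ∑ s : Finset W, μ.real (u s) := Finset.sum_le_sum fun s _ => hterm s
    _ = μ.real (⋃ s ∈ (Finset.univ : Finset (Finset W)), u s) := by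
        rw [measureReal_biUnion_finset]
        · intro s _ t _ hst
          exact Set.disjoint_left.2 fun ω hs ht => hst (hgdisj s t ω hs.1 ht.1)
        · exact fun s _ => (hle _ _ (hgm s)).diff (hcm s)
    _ ≤ μ.real (⋃ w, F w ∩ E w) := measureReal_mono hsub

end Branching

/-! ### Rays of descendants -/

section Rays

variable {b : ℕ}

/-- The ray from `x` that passes from each vertex to the child indicated by `l`. -/
def ray (c : V → Fin b → V) (x : V) (l : ℕ → Fin b) : ℕ → V
  | 0 => x
  | j + 1 => c (ray c x l j) (l j)

/-- The descendants of `x`. -/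
def descendants (c : V → Fin b → V) (x : V) : Set V := {v | ∃ l j, ray c x l j = v}

/-- The descendants of `x` in the first `N` generations, including `x`. -/
def block (c : V → Fin b → V) (N : ℕ) (x : V) : Set V := {v | ∃ l, ∃ j < N, ray c x l j = v}

/-- Extension of a word to an infinite sequence. -/
def extend [NeZero b] {N : ℕ} (w : Fin N → Fin b) (j : ℕ) : Fin b :=
  if h : j < N then w ⟨j, h⟩ else 0

lemma extend_injective [NeZero b] {N : ℕ} {w w' : Fin N → Fin b}
    (h : ∀ j < N, extend w j = extend w' j) : w = w' := by
  ext j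
  have := h j j.2
  simp only [extend, j.2, dif_pos] at this
  rw [this]

lemma ray_congr (c : V → Fin b → V) (x : V) {l l' : ℕ → Fin b} (N : ℕ)
    (h : ∀ i < N, l i = l' i) : ray c x l N = ray c x l' N := by
  induction N with
  | zero => rfl
  | succ N ih => rw [ray, ray, ih fun i hi => h i (by omega), h N (by omega)]

lemma ray_ray (c : V → Fin b → V) (x : V) (l l' : ℕ → Fin b) (N j : ℕ) :
    ray c (ray c x l N) l' j = ray c x (fun i => if i < N then l i else l' (i - N)) (N + j) := by
  induction j with
  | zero => exact ray_congr c x N fun i hi => by simp [hi]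
  | succ j ih => simp only [ray, ih]; simp

lemma descendants_ray_subset (c : V → Fin b → V) (x : V) (l : ℕ → Fin b) (N : ℕ) :
    descendants c (ray c x l N) ⊆ descendants c x := by
  rintro v ⟨l', j, rfl⟩
  exact ⟨_, _, (ray_ray c x l l' N j).symm⟩

lemma block_subset_descendants (c : V → Fin b → V) (N : ℕ) (x : V) :
    block c N x ⊆ descendants c x := by
  rintro v ⟨l, j, -, rfl⟩
  exact ⟨l, j, rfl⟩

variable {c : V → Fin b → V} {G : SimpleGraph V} {o : V}
  (hinj : ∀ x a y e, c x a = c y e → x = y ∧ a = e) (hadj : ∀ x a, G.Adj x (c x a))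
  (hdist : ∀ x a, G.dist o (c x a) = G.dist o x + 1)

include hdist in
lemma dist_root_ray (x : V) (l : ℕ → Fin b) (j : ℕ) :
    G.dist o (ray c x l j) = G.dist o x + j := by
  induction j with
  | zero => rfl
  | succ j ih => rw [ray, hdist, ih, add_assoc]

include hdist hadj in
lemma dist_ray (hG : G.Connected) (x : V) (l : ℕ → Fin b) (i k : ℕ) :
    G.dist (ray c x l i) (ray c x l (i + k)) = k := by
  refine le_antisymm ?_ ?_
  · exact dist_trajectory_le (w := fun j => ray c x l (i + j)) (fun j => hadj _ _) k
  · have h := hG.dist_triangle (u := o) (v := ray c x l i) (w := ray c x l (i + k))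
    rw [dist_root_ray hdist, dist_root_ray hdist] at h
    omega

-- The distance to the root gives the generation; the letters are then recovered from the last one
-- backwards.
include hinj hdist in
lemma ray_injective (x : V) {l l' : ℕ → Fin b} {j j' : ℕ} (h : ray c x l j = ray c x l' j') :
    j = j' ∧ ∀ i < j, l i = l' i := by
  have hj : j = j' := by
    have := congrArg (G.dist o) h
    rw [dist_root_ray hdist, dist_root_ray hdist] at this
    omega
  subst hj
  refine ⟨rfl, ?_⟩
  induction j with
  | zero => simp
  | succ j ih =>
    obtain ⟨h1, h2⟩ := hinj _ _ _ _ h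
    intro i hi
    rcases Nat.lt_succ_iff_lt_or_eq.1 hi with hi | rfl
    exacts [ih h1 i hi, h2]

include hinj hdist in
lemma disjoint_block_descendants (x : V) (l : ℕ → Fin b) (N : ℕ) :
    Disjoint (block c N x) (descendants c (ray c x l N)) := by
  refine Set.disjoint_left.2 ?_
  rintro v ⟨l₁, j₁, hj₁, rfl⟩ ⟨l₂, j₂, h⟩
  rw [ray_ray] at h
  have := (ray_injective hinj hdist x h).1
  omega

include hinj hdist in
lemma pairwise_disjoint_descendants [NeZero b] (x : V) (N : ℕ) :
    Pairwise (Function.onFun Disjoint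
      fun w : Fin N → Fin b => descendants c (ray c x (extend w) N)) := by
  intro w w' hww
  refine Set.disjoint_left.2 ?_
  rintro v ⟨l₁, j₁, rfl⟩ ⟨l₂, j₂, h⟩
  rw [ray_ray, ray_ray] at h
  refine hww (extend_injective fun j hj => ?_)
  have := (ray_injective hinj hdist x h).2 j (by omega)
  simpa [hj] using this.symm

end Rays

/-! ### The embedded branching process -/

section Embedded

variable {b : ℕ}

/-- The first particle from the `i`-th vertex of a ray visits all its vertices up to the `k`-th. -/
def reachesAlong (y : ℕ → V) (i k : ℕ) : Set (Config V) :=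
  ⋂ j ∈ Finset.Ioc i k, {ω | Reaches ω (y i) (y j)}

/-- Requiring all intermediate visits makes this hold for every realization, not just almost surely.
-/
lemma antitone_reachesAlong (y : ℕ → V) (i : ℕ) : Antitone (reachesAlong y i) := fun _ _ hk =>
  Set.biInter_subset_biInter_left fun _ hj =>
    Finset.mem_Ioc.2 ⟨(Finset.mem_Ioc.1 hj).1, (Finset.mem_Ioc.1 hj).2.trans hk⟩

lemma measurableSet_reachesAlong [MeasurableSpace V] [MeasurableSingletonClass V] (y : ℕ → V)
    (i k : ℕ) :
    MeasurableSet[MeasurableSpace.comap (site (y i)) inferInstance] (reachesAlong y i k) := by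
  refine Finset.measurableSet_biInter _ fun j _ => ?_
  exact ⟨reachSet (y j), measurableSet_reachSet _, rfl⟩

/-- Starting from `x`, some descendant in generation `n * N` is reached, where each piece of `N`
generations is covered by particles inside it. -/
def embedded (c : V → Fin b → V) [NeZero b] (N : ℕ) : ℕ → V → Set (Config V)
  | 0, _ => Set.univ
  | n + 1, x => ⋃ w : Fin N → Fin b, cover (reachesAlong (ray c x (extend w))) N ∩
      embedded c N n (ray c x (extend w) N)

lemma embedded_succ_subset (c : V → Fin b → V) [NeZero b] (N n : ℕ) (x : V) :
    embedded c N (n + 1) x ⊆ embedded c N n x := by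
  induction n generalizing x with
  | zero => exact Set.subset_univ _
  | succ n ih =>
    rw [embedded.eq_def c N (n + 1 + 1), embedded.eq_def c N (n + 1)]
    exact Set.iUnion_mono fun w => Set.inter_subset_inter_right _ (ih _)

/-- Each edge is crossed by a particle from an earlier vertex of the ray, which is already woken by
strong induction. -/
lemma wakeTime_lt_top_of_mem_cover {y : ℕ → V} {N : ℕ} {o : V} {ω : Config V}
    (hω : ω ∈ cover (reachesAlong y) N) (h0 : ω.wakeTime o (y 0) < ⊤) {j : ℕ} (hj : j ≤ N) :
    ω.wakeTime o (y j) < ⊤ := by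
  induction j using Nat.strong_induction_on with
  | _ j ih =>
    rcases j with _ | j
    · exact h0
    · simp only [cover, Set.mem_iInter, Set.mem_iUnion] at hω
      obtain ⟨i, hi, hij⟩ := hω j (by omega)
      have hr : Reaches ω (y i) (y (j + 1)) :=
        Set.mem_iInter₂.1 hij (j + 1) (Finset.mem_Ioc.2 ⟨by omega, le_rfl⟩)
      exact hr.wakeTime_lt_top (ih i (by omega) (by omega))

lemma exists_woken_of_mem_embedded {c : V → Fin b → V} [NeZero b] {G : SimpleGraph V} {o : V}
    (hdist : ∀ x a, G.dist o (c x a) = G.dist o x + 1) {N n : ℕ} {x : V} {ω : Config V}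
    (hω : ω ∈ embedded c N n x) (hx : ω.wakeTime o x < ⊤) :
    ∃ v, G.dist o v = G.dist o x + n * N ∧ ω.wakeTime o v < ⊤ := by
  induction n generalizing x with
  | zero => exact ⟨x, by simp, hx⟩
  | succ n ih =>
    rw [embedded, Set.mem_iUnion] at hω
    obtain ⟨w, hw, hω⟩ := hω
    obtain ⟨v, hv, hvT⟩ := ih hω (wakeTime_lt_top_of_mem_cover hw hx le_rfl)
    refine ⟨v, ?_, hvT⟩
    rw [hv, dist_root_ray hdist]
    ring

/-- The `N` edges are crossed by particles with index below `N`, so the particle at the endpoint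
remains unused for the next piece. -/
lemma measurableSet_cover_block [MeasurableSpace V] [MeasurableSingletonClass V]
    (c : V → Fin b → V) (N : ℕ) (x : V) (l : ℕ → Fin b) :
    MeasurableSet[⨆ v ∈ block c N x, MeasurableSpace.comap (site v) inferInstance]
      (cover (reachesAlong (ray c x l)) N) :=
  measurableSet_cover fun i hi k => measurableSet_iSup_of_mem
    (m := fun v : V => MeasurableSpace.comap (site v) inferInstance) (S := block c N x)
    ⟨l, i, hi, rfl⟩ (measurableSet_reachesAlong _ i k)

lemma measurableSet_embedded [MeasurableSpace V] [MeasurableSingletonClass V]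
    (c : V → Fin b → V) [NeZero b] (N n : ℕ) (x : V) :
    MeasurableSet[⨆ v ∈ descendants c x, MeasurableSpace.comap (site v) inferInstance]
      (embedded c N n x) := by
  induction n generalizing x with
  | zero => exact MeasurableSet.univ
  | succ n ih =>
    rw [embedded]
    refine MeasurableSet.iUnion fun w => MeasurableSet.inter ?_ ?_
    · exact measurableSet_iSup_mono (block_subset_descendants c N x)
        (measurableSet_cover_block c N x _)
    · exact measurableSet_iSup_mono (descendants_ray_subset c x _ N) (ih _)

variable [MeasurableSpace V] [DiscreteMeasurableSpace V] [Countable V] (G : SimpleGraph V)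
  [G.LocallyFinite] (p : I) (η : Measure ℕ) [IsProbabilityMeasure η]

lemma le_law_cover (hG : G.IsTree) (hreg : G.IsRegularOfDegree (b + 1)) {h : ℝ} (h0 : 0 ≤ h)
    (h1 : h ≤ 1) (hp1 : p < 1) (hp : h * (b + 1) = p * (1 + b * h ^ 2)) {o : V}
    {c : V → Fin b → V} (hinj : ∀ x a y e, c x a = c y e → x = y ∧ a = e)
    (hadj : ∀ x a, G.Adj x (c x a)) (hdist : ∀ x a, G.dist o (c x a) = G.dist o x + 1)
    (x : V) (l : ℕ → Fin b) (n : ℕ) :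
    η.real {n | 1 ≤ n} * h ^ (n + 1) * (1 + η.real {n | 1 ≤ n} * (1 - h)) ^ n ≤
      (law G p η).real (cover (reachesAlong (ray c x l)) (n + 1)) := by
  set y := ray c x l with hy
  have hyinj : Function.Injective y := fun i j hij => (ray_injective hinj hdist x hij).1
  have hind : iIndep (fun i => MeasurableSpace.comap (site (y i)) inferInstance) (law G p η) :=
    (iIndep_site G p η).precomp hyinj
  rw [cover_succ]
  refine le_measureReal_coverReach (fun i => (measurable_site (y i)).comap_le) hind
    (antitone_reachesAlong y) (measurableSet_reachesAlong y) measureReal_nonneg h0 h1 ?_ n 1 le_rfl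
  intro i k
  rcases Nat.eq_zero_or_pos k with rfl | hk
  -- For `k = 0` nothing has to be visited, and the bound reads `q ≤ 1`.
  · simp [reachesAlong]
  have hle : law G p η {ω | Reaches ω (y i) (y (i + k))} ≤ law G p η (reachesAlong y i (i + k)) := by
    refine measure_mono_ae ?_
    filter_upwards [ae_nearestNeighbour G p η (Nat.succ_pos b) hreg] with ω hω hr
    refine Set.mem_iInter₂.2 fun j hj => ?_
    obtain ⟨hij, hjk⟩ := Finset.mem_Ioc.1 hj
    obtain ⟨s, rfl⟩ := Nat.exists_eq_add_of_le hij.le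
    obtain ⟨t, ht⟩ := Nat.exists_eq_add_of_le hjk
    refine Reaches.of_dist_add_dist hG hω hr ?_
    rw [ht, hy, dist_ray hadj hdist hG.1, dist_ray hadj hdist hG.1, add_assoc,
      dist_ray hadj hdist hG.1]
  have hge := (law_reaches_ge G p η hG.1 hreg h0 h1 hp1 hp (y i) (y (i + k))).trans hle
  rw [hy, dist_ray hadj hdist hG.1] at hge
  have := ENNReal.toReal_mono (measure_ne_top _ _) hge
  rwa [ENNReal.toReal_mul, ENNReal.toReal_ofReal (by positivity)] at this

lemma le_law_embedded [NeZero b] (hG : G.IsTree) (hreg : G.IsRegularOfDegree (b + 1)) {h : ℝ}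
    (h0 : 0 ≤ h) (h1 : h ≤ 1) (hp1 : p < 1) (hp : h * (b + 1) = p * (1 + b * h ^ 2)) {o : V}
    {c : V → Fin b → V} (hinj : ∀ x a y e, c x a = c y e → x = y ∧ a = e)
    (hadj : ∀ x a, G.Adj x (c x a)) (hdist : ∀ x a, G.dist o (c x a) = G.dist o x + 1) {N : ℕ}
    {M θ : ℝ} (θ0 : 0 ≤ θ) (θ1 : θ ≤ 1) (hθ : (b : ℝ) ^ (N + 1) * θ ≤ 1)
    (hMθ : 1 ≤ M * (1 - (b : ℝ) ^ (N + 1) * θ))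
    (hM : M ≤ (b : ℝ) ^ (N + 1) *
      (η.real {n | 1 ≤ n} * h ^ (N + 1) * (1 + η.real {n | 1 ≤ n} * (1 - h)) ^ N))
    (n : ℕ) (x : V) : θ ≤ (law G p η).real (embedded c (N + 1) n x) := by
  induction n generalizing x with
  | zero => simpa [embedded] using θ1
  | succ n ih =>
    have hcard : ((Fintype.card (Fin (N + 1) → Fin b) : ℕ) : ℝ) = (b : ℝ) ^ (N + 1) := by simp
    rw [embedded]
    refine le_measureReal_exists_good (M := M) (fun v => (measurable_site v).comap_le)
      (iIndep_site G p η)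
      (fun w => disjoint_block_descendants hinj hdist x (extend w) (N + 1))
      (pairwise_disjoint_descendants hinj hdist x (N + 1))
      (fun w => measurableSet_cover_block c (N + 1) x (extend w))
      (fun w => measurableSet_embedded c (N + 1) n _) θ0 (fun w => ih _) ?_ θ1
      (by rwa [hcard]) (by rwa [hcard])
    refine hM.trans ?_
    rw [← hcard, ← nsmul_eq_mul]
    exact Finset.card_nsmul_le_sum _ _ _ fun w _ =>
      le_law_cover G p η hG hreg h0 h1 hp1 hp hinj hadj hdist x (extend w) N

lemma law_survives_pos [NeZero b] (hG : G.IsTree) (hreg : G.IsRegularOfDegree (b + 1)) {h : ℝ}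
    (h0 : 0 < h) (h1 : h ≤ 1) (hp1 : p < 1) (hp : h * (b + 1) = p * (1 + b * h ^ 2))
    (hq : 0 < η.real {n | 1 ≤ n}) (hsup : 1 < b * h * (1 + η.real {n | 1 ≤ n} * (1 - h))) (o : V) :
    0 < law G p η {ω | ω.Survives o} := by
  obtain ⟨c, hadj, hdist, hinj⟩ := exists_child hG hreg o
  set q := η.real {n | 1 ≤ n}
  set r := 1 + q * (1 - h) with hr
  have hr1 : 1 ≤ r := by
    have : 0 ≤ 1 - h := by linarith
    have : 0 ≤ q * (1 - h) := by positivity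
    linarith
  have hb : (1 : ℝ) ≤ b := by exact_mod_cast Nat.one_le_iff_ne_zero.2 (NeZero.ne b)
  -- Since `M = (q / r) (b h r) ^ (N + 1)`, this makes `M > 1`.
  obtain ⟨N, hN⟩ := pow_unbounded_of_one_lt (r / q) hsup
  set M := (b : ℝ) ^ (N + 1) * (q * h ^ (N + 1) * r ^ N) with hM
  have hM1 : 1 < M := by
    have h2 : 1 < q / r * (b * h * r) ^ N := by
      rw [div_lt_iff₀ hq] at hN
      rw [div_mul_eq_mul_div, one_lt_div (by positivity)]
      linarith
    have h3 : M = q / r * (b * h * r) ^ N * (b * h * r) := by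
      rw [hM, eq_comm, div_mul_eq_mul_div, div_mul_eq_mul_div, div_eq_iff (by positivity)]
      rw [pow_succ, pow_succ, mul_pow, mul_pow]
      ring
    rw [h3]
    exact one_lt_mul_of_lt_of_le h2 hsup.le
  set D := (b : ℝ) ^ (N + 1) with hD
  have hD1 : 1 ≤ D := one_le_pow₀ hb
  -- This `θ` solves `M (1 - D θ) = 1`, the equality case of the branching step.
  set θ := (M - 1) / (M * D) with hθ
  have hM0 : 0 < M := by linarith
  have hDθ : D * θ = 1 - 1 / M := by
    rw [hθ]; field_simp
  have θ0 : 0 < θ := div_pos (by linarith) (by positivity)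
  have hM' : 0 < 1 / M := by positivity
  have hDθ1 : D * θ ≤ 1 := by linarith
  have θ1 : θ ≤ 1 := le_trans (le_mul_of_one_le_left θ0.le hD1) hDθ1
  have hle := le_law_embedded G p η hG hreg h0.le h1 hp1 hp hinj hadj hdist (N := N) (M := M)
    θ0.le θ1 hDθ1 (by rw [← hD, hDθ]; field_simp; simp) le_rfl
  have hlim : ENNReal.ofReal θ ≤ law G p η (⋂ n, embedded c (N + 1) n o) := by
    rw [(antitone_nat_of_succ_le fun n => embedded_succ_subset c (N + 1) n o).measure_iInter
      (fun n => ?_) ⟨0, measure_ne_top _ _⟩]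
    · refine le_iInf fun n => ?_
      rw [← ofReal_measureReal]
      exact ENNReal.ofReal_le_ofReal (hle n o)
    · refine MeasurableSet.nullMeasurableSet ?_
      exact (iSup₂_le fun v _ => (measurable_site v).comap_le :
        (⨆ v ∈ descendants c o, MeasurableSpace.comap (site v) inferInstance) ≤ _) _
        (measurableSet_embedded c (N + 1) n o)
  refine (ENNReal.ofReal_pos.2 θ0).trans_le (hlim.trans (measure_mono_ae ?_))
  filter_upwards [ae_nearestNeighbour G p η (Nat.succ_pos b) hreg] with ω hω hmem
  refine survives_of_unbounded hG.1 hω o fun n => ?_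
  obtain ⟨v, hv, hvT⟩ := exists_woken_of_mem_embedded hdist (Set.mem_iInter.1 hmem n)
    (by rw [wakeTime_root]; exact ENat.natCast_lt_top 0)
  refine ⟨v, ?_, hvT⟩
  rw [hv]
  nlinarith

end Embedded

/-! ### Choice of parameters -/

/-- The parameter `h` can be chosen below `1 / b` and so that the embedded process is
supercritical. -/
lemma exists_supercritical {b : ℕ} (hb : 2 ≤ b) {q : ℝ} (hq : 0 < q) :
    ∃ h : ℝ, 0 < h ∧ b * h < 1 ∧ 1 < b * h * (1 + q * (1 - h)) := by
  have hb' : (2 : ℝ) ≤ b := by exact_mod_cast hb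
  have hb0 : (0 : ℝ) < b := by linarith
  -- Here `t = b h`. At `t = 1` the value is `1 + q (1 - 1 / b)`, which exceeds `1` because `b ≥ 2`.
  have hcont : Continuous fun t : ℝ => t * (1 + q * (1 - t / b)) := by fun_prop
  have hval : (1 : ℝ) < 1 * (1 + q * (1 - 1 / b)) := by
    have : (1 : ℝ) / b < 1 := by rw [div_lt_one hb0]; linarith
    have : 0 < q * (1 - 1 / b) := mul_pos hq (by linarith)
    linarith
  have hev := (hcont.tendsto 1).eventually (lt_mem_nhds hval)
  have hev2 : ∀ᶠ t : ℝ in nhds 1, 0 < t := lt_mem_nhds one_pos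
  obtain ⟨t, ⟨ht1, ht2⟩, ht3⟩ :=
    (((hev.and hev2).filter_mono nhdsWithin_le_nhds).and
      (self_mem_nhdsWithin : Set.Iio (1 : ℝ) ∈ nhdsWithin 1 (Set.Iio 1))).exists
  refine ⟨t / b, by positivity, ?_, ?_⟩
  · rw [mul_div_cancel₀ _ hb0.ne']; exact ht3
  · rw [mul_div_cancel₀ _ hb0.ne']; exact ht1

end FrogModel

end

/-- On the homogeneous tree of degree `d ≥ 3`, with any vertex as root, the frog model whose
initial numbers of particles are not almost surely zero has critical parameter below `1`. -/
theorem theorem2p5 {V : Type*} [MeasurableSpace V] [DiscreteMeasurableSpace V]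
    (G : SimpleGraph V) [G.LocallyFinite] (d : ℕ) (hd : 3 ≤ d) (hG : G.IsTree)
    (hreg : G.IsRegularOfDegree d) (o : V) (η : Measure ℕ) [IsProbabilityMeasure η]
    (hη : 0 < η {n | 1 ≤ n}) :
    FrogModel.criticalParameter G o η < 1 := by
  have := FrogModel.countable_of_connected hG.1
  obtain ⟨b, rfl⟩ : ∃ b, d = b + 1 := ⟨d - 1, by omega⟩
  have : NeZero b := ⟨by omega⟩
  have hq : 0 < η.real {n | 1 ≤ n} := ENNReal.toReal_pos hη.ne' (measure_ne_top _ _)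
  obtain ⟨h, h0, hbh, hsup⟩ := FrogModel.exists_supercritical (by omega : 2 ≤ b) hq
  have hb : (2 : ℝ) ≤ b := by exact_mod_cast (by omega : 2 ≤ b)
  have h1 : h < 1 := by nlinarith
  have hden : 0 < 1 + b * h ^ 2 := by positivity
  -- The quadratic equation is solved for `p`; `p < 1` amounts to `(1 - h) (1 - b h) > 0`.
  have hlt : h * (b + 1) / (1 + b * h ^ 2) < 1 := by
    rw [div_lt_one hden]
    nlinarith [mul_pos (sub_pos.2 h1) (sub_pos.2 hbh)]
  let p : unitInterval := ⟨h * (b + 1) / (1 + b * h ^ 2), by positivity, hlt.le⟩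
  have hp1 : p < 1 := hlt
  refine lt_of_le_of_lt (sInf_le ?_) hp1
  exact FrogModel.law_survives_pos G p η hG hreg h0 h1.le hp1
    (div_mul_cancel₀ _ hden.ne').symm hq hsup o
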